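/- Fix a probability space $(\Omega,\mathcal A,\mathbb P)$, and write $\mathcal B_B(X)$ for the bounded Borel subsets of a Euclidean space $X$. A \emph{real measure} on $X$ is a $\sigma$-additive function $\mathcal B_B(X)\to\mathbb R$. A \emph{random measure} on $X$ is a $\sigma$-additive function $M:\mathcal B_B(X)\to L^2(\Omega,\mathcal A,\mathbb P)$ (real-valued) for which there is a real measure $C_M$ on $X\times X$, its \emph{covariance measure}, with $C_M(A\times B)=\operatorname{Cov}(M(A),M(B))$ for all $A,B\in\mathcal B_B(X)$; its \emph{mean measure} is $m_M(A)=\mathbb E(M(A))$, and $M$ is \emph{centred} if $m_M=0$. Let $M_1$ and $M_2$ be random measures on $\mathbb R^d$ and $\mathbb R^p$ that are jointly Gaussian, i.e. every vector $(M_1(A_1),\dots,M_1(A_n),M_2(B_1),\dots,M_2(B_m))$ with $A_i\in\mathcal B_B(\mathbb R^d)$, $B_j\in\mathcal B_B(\mathbb R^p)$ is a (possibly degenerate) Gaussian vector. Suppose that there is a real measure $C_{M_1,M_2}$ on $\mathbb R^d\times\mathbb R^p$ with $\operatorname{Cov}(M_1(A),M_2(B))=C_{M_1,M_2}(A\times B)$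 for all $A\in\mathcal B_B(\mathbb R^d)$, $B\in\mathcal B_B(\mathbb R^p)$. Then: (1) There is a unique random measure $M_1\otimes M_2$ on $\mathbb R^d\times\mathbb R^p$ such that $$(M_1\otimes M_2)(A\times B)=M_1(A)\,M_2(B)\quad\text{a.s.},\qquad \forall A\in\mathcal B_B(\mathbb R^d),\ B\in\mathcal B_B(\mathbb R^p).$$ (2) There are unique real measures $C_{M_1}\text{``}\otimes\text{''}C_{M_2}$ and $C_{M_1,M_2}\text{``}\otimes\text{''}C_{M_1,M_2}$ on $(\mathbb R^d\times\mathbb R^p)\times(\mathbb R^d\times\mathbb R^p)$ such that, for all $A_1,A_2\in\mathcal B_B(\mathbb R^d)$ and $B_1,B_2\in\mathcal B_B(\mathbb R^p)$, $$(C_{M_1}\text{``}\otimes\text{''}C_{M_2})(A_1\times B_1\times A_2\times B_2)=C_{M_1}(A_1\times A_2)\,C_{M_2}(B_1\times B_2),$$ $$(C_{M_1,M_2}\text{``}\otimes\text{''}C_{M_1,M_2})(A_1\times B_1\times A_2\times B_2)=C_{M_1,M_2}(A_1\times B_2)\,C_{M_1,M_2}(A_2\times B_1).$$ (3) If $M_1$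 and $M_2$ are centred, then $$m_{M_1\otimes M_2}=C_{M_1,M_2},\qquad C_{M_1\otimes M_2}=C_{M_1}\text{``}\otimes\text{''}C_{M_2}+C_{M_1,M_2}\text{``}\otimes\text{''}C_{M_1,M_2}.$$ -/

import Mathlib

open MeasureTheory ProbabilityTheory

/-- Bounded Borel sets (on `ℝ^d`, or on `ℝ^d × ℝ^p`, which carries the product `σ`-algebra and the
product bornology). -/
def IsBoundedBorel {X : Type*} [MeasurableSpace X] [Bornology X] (A : Set X) : Prop :=
  MeasurableSet A ∧ Bornology.IsBounded A

/-- A `σ`-additive `V`-valued function on the `δ`-ring of bounded Borel sets of `X`.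
As for `MeasureTheory.VectorMeasure`, it is extended by `0` to all other sets, so that two of them
are equal exactly when they agree on the bounded Borel sets. -/
@[ext]
structure LocalVectorMeasure (X : Type*) [MeasurableSpace X] [Bornology X]
    (V : Type*) [AddCommMonoid V] [TopologicalSpace V] where
  toFun : Set X → V
  eq_zero_of_not' : ∀ A : Set X, ¬ IsBoundedBorel A → toFun A = 0
  hasSum_iUnion' : ∀ A : ℕ → Set X, (∀ n, IsBoundedBorel (A n)) →
    Bornology.IsBounded (⋃ n, A n) → Pairwise (Function.onFun Disjoint A) →
    HasSum (fun n => toFun (A n)) (toFun (⋃ n, A n))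

namespace LocalVectorMeasure

variable {X : Type*} [MeasurableSpace X] [Bornology X]
  {V : Type*} [AddCommMonoid V] [TopologicalSpace V]

instance : CoeFun (LocalVectorMeasure X V) (fun _ => Set X → V) := ⟨toFun⟩

instance [ContinuousAdd V] : Add (LocalVectorMeasure X V) where
  add μ ν :=
    { toFun := fun A => μ A + ν A
      eq_zero_of_not' := fun A hA => by
        rw [μ.eq_zero_of_not' A hA, ν.eq_zero_of_not' A hA, add_zero]
      hasSum_iUnion' := fun A hA hU hd =>
        (μ.hasSum_iUnion' A hA hU hd).add (ν.hasSum_iUnion' A hA hU hd) }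

end LocalVectorMeasure

/-- The real measures on `X`: locally finite signed measures, defined on bounded Borel sets. -/
abbrev RealMeasure (X : Type*) [MeasurableSpace X] [Bornology X] := LocalVectorMeasure X ℝ

/-- A (real, second-order, measure-covariance) random measure on `X`: a `σ`-additive
`L²(Ω, P)`-valued function on the bounded Borel sets, whose covariance is given by a real measure
on `X × X`. -/
@[ext]
structure RandomMeasure {Ω : Type*} [MeasurableSpace Ω] (P : Measure Ω)
    (X : Type*) [MeasurableSpace X] [Bornology X] extends LocalVectorMeasure X (Lp ℝ 2 P) where
  exists_cov' : ∃ C : RealMeasure (X × X), ∀ A B : Set X, IsBoundedBorel A → IsBoundedBorel B →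
    C (A ×ˢ B) = cov[toFun A, toFun B; P]

namespace RandomMeasure

variable {Ω : Type*} [MeasurableSpace Ω] {P : Measure Ω}
  {X : Type*} [MeasurableSpace X] [Bornology X] {Y : Type*} [MeasurableSpace Y] [Bornology Y]

instance : CoeFun (RandomMeasure P X) (fun _ => Set X → Lp ℝ 2 P) := ⟨fun M => M.toFun⟩

/-- The mean measure `A ↦ 𝔼[M A]`. -/
noncomputable def meanMeasure [IsProbabilityMeasure P] (M : RandomMeasure P X) :
    RealMeasure X where
  toFun A := ∫ ω, M A ω ∂P
  eq_zero_of_not' A hA := by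
    rw [M.eq_zero_of_not' A hA, integral_congr_ae (Lp.coeFn_zero ℝ 2 P)]
    simp
  hasSum_iUnion' A hA hU hd := by
    have key : ∀ f : Lp ℝ 2 P, ∫ ω, f ω ∂P = innerSL ℝ
        (indicatorConstLp 2 MeasurableSet.univ (measure_ne_top P Set.univ) (1 : ℝ)) f := by
      intro f
      rw [innerSL_apply_apply, L2.inner_indicatorConstLp_one, setIntegral_univ]
    simp only [key]
    exact (M.hasSum_iUnion' A hA hU hd).mapL _

/-- The covariance measure of `M`: the real measure on `X × X` whose value at `A × B` is
`Cov(M A, M B)`, for bounded Borel sets `A` and `B`. -/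
noncomputable def covMeasure (M : RandomMeasure P X) : RealMeasure (X × X) :=
  M.exists_cov'.choose

theorem covMeasure_prod (M : RandomMeasure P X) {A B : Set X}
    (hA : IsBoundedBorel A) (hB : IsBoundedBorel B) :
    M.covMeasure (A ×ˢ B) = cov[M A, M B; P] :=
  M.exists_cov'.choose_spec A B hA hB

/-- `M` is centred if every `M A` has expectation zero. -/
def IsCentred (M : RandomMeasure P X) : Prop :=
  ∀ A : Set X, IsBoundedBorel A → ∫ ω, M A ω ∂P = 0

/-- `M₁` and `M₂` are jointly Gaussian: all the vectors
`(M₁ A₁, …, M₁ Aₙ, M₂ B₁, …, M₂ Bₘ)`, for bounded Borel sets `Aᵢ`, `Bⱼ`, are (possibly degenerate)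
Gaussian vectors. -/
def JointlyGaussian (M₁ : RandomMeasure P X) (M₂ : RandomMeasure P Y) : Prop :=
  IsGaussianProcess
    (Sum.elim (fun (A : {A : Set X // IsBoundedBorel A}) (ω : Ω) => M₁ A.1 ω)
      (fun (B : {B : Set Y // IsBoundedBorel B}) (ω : Ω) => M₂ B.1 ω)) P

/-- The cross-covariance of `M₁` and `M₂` is given by the real measure `C` on `X × Y`. -/
def IsCrossCovariance (M₁ : RandomMeasure P X) (M₂ : RandomMeasure P Y)
    (C : RealMeasure (X × Y)) : Prop :=
  ∀ (A : Set X) (B : Set Y), IsBoundedBorel A → IsBoundedBorel B →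
    cov[M₁ A, M₂ B; P] = C (A ×ˢ B)

/-- The random measure `M` on `X × Y` satisfies `M (A × B) = M₁ A * M₂ B` almost surely, that is,
as elements of `L²`, for all bounded Borel sets `A` and `B`. -/
def IsTensorProduct (M₁ : RandomMeasure P X) (M₂ : RandomMeasure P Y)
    (M : RandomMeasure P (X × Y)) : Prop :=
  ∀ (A : Set X) (B : Set Y), IsBoundedBorel A → IsBoundedBorel B →
    M (A ×ˢ B) =ᵐ[P] fun ω => M₁ A ω * M₂ B ω

end RandomMeasure

/-- `T` is the reordered product `C₁ "⊗" C₂` of a real measure `C₁` on `X × X` and a real measure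
`C₂` on `Y × Y`. -/
def IsReorderedProduct {X Y : Type*} [MeasurableSpace X] [Bornology X]
    [MeasurableSpace Y] [Bornology Y] (C₁ : RealMeasure (X × X)) (C₂ : RealMeasure (Y × Y))
    (T : RealMeasure ((X × Y) × (X × Y))) : Prop :=
  ∀ (A₁ A₂ : Set X) (B₁ B₂ : Set Y), IsBoundedBorel A₁ → IsBoundedBorel A₂ →
    IsBoundedBorel B₁ → IsBoundedBorel B₂ →
    T ((A₁ ×ˢ B₁) ×ˢ (A₂ ×ˢ B₂)) = C₁ (A₁ ×ˢ A₂) * C₂ (B₁ ×ˢ B₂)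

/-- `T` is the crossed product `C "⊗" C` of a real measure `C` on `X × Y` with itself. -/
def IsCrossedProduct {X Y : Type*} [MeasurableSpace X] [Bornology X]
    [MeasurableSpace Y] [Bornology Y] (C : RealMeasure (X × Y))
    (T : RealMeasure ((X × Y) × (X × Y))) : Prop :=
  ∀ (A₁ A₂ : Set X) (B₁ B₂ : Set Y), IsBoundedBorel A₁ → IsBoundedBorel A₂ →
    IsBoundedBorel B₁ → IsBoundedBorel B₂ →
    T ((A₁ ×ˢ B₁) ×ˢ (A₂ ×ˢ B₂)) = C (A₁ ×ˢ B₂) * C (A₂ ×ˢ B₁)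

/-! The products `M₁ A * M₂ B` prescribe an `L²`-valued set function on rectangles; the point is to
extend it σ-additively. By the Isserlis formula (`IsGaussianProcess.integral_mul_mul_mul`), the
inner product of two such variables is a polynomial in first and second moments. Each term is the
value on a fourfold rectangle of a product of real measures, up to a permutation of coordinates, so
the whole Gram matrix is given by one real measure `S` on `(X × Y) × (X × Y)`
(`JointlyGaussian.exists_moment`).

A Gram matrix of this kind forces an extension (`VectorMeasure.exists_of_gram`). On a bounded box
write `S = p - q` (Jordan) and let `ν` be the sum of the marginals of `p` and `q`. For a step
function `g = ∑ cᵢ 1_{Rᵢ}`, the variable `∑ cᵢ f(Rᵢ)` has squared norm `∫ g(x) g(y) dS ≤ ∫ g² dν`.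
Hence `1_R ↦ f(R)` extends to a contraction from `L²(ν)` to `L²(P)`, and composing it with the
σ-additive map `E ↦ 1_E` gives the measure on the box. The boxes are then glued along an exhaustion.

Uniqueness is the π-system argument on boxes, applied in one factor at a time for fourfold
rectangles. The same argument carries the Gram identity from rectangles to all bounded Borel sets,
so subtracting the product of the means yields the covariance measure. In the centred case, the
Isserlis pairings that remain in the covariance are the two "⊗" measures. -/

/-! ### Bounded Borel sets and exhaustions by boxes -/

namespace IsBoundedBorel

variable {X : Type*} [MeasurableSpace X] [Bornology X] {Y : Type*} [MeasurableSpace Y] [Bornology Y]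

theorem inter_left {K A : Set X} (hK : IsBoundedBorel K) (hA : MeasurableSet A) :
    IsBoundedBorel (A ∩ K) :=
  ⟨hA.inter hK.1, hK.2.subset Set.inter_subset_right⟩

theorem prod {A : Set X} {B : Set Y} (hA : IsBoundedBorel A) (hB : IsBoundedBorel B) :
    IsBoundedBorel (A ×ˢ B) :=
  ⟨hA.1.prod hB.1, hA.2.prod hB.2⟩

end IsBoundedBorel

/-- The bounded sets of `X` are exhausted by a sequence of bounded Borel sets. -/
class CountablyExhausted (X : Type*) [MeasurableSpace X] [Bornology X] : Prop where
  exists_exhaustion : ∃ K : ℕ → Set X, Monotone K ∧ (∀ n, IsBoundedBorel (K n)) ∧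
    ∀ A : Set X, Bornology.IsBounded A → ∃ n, A ⊆ K n

instance {X : Type*} [PseudoMetricSpace X] [MeasurableSpace X] [OpensMeasurableSpace X] :
    CountablyExhausted X where
  exists_exhaustion := by
    rcases isEmpty_or_nonempty X with h | ⟨⟨x⟩⟩
    · exact ⟨fun _ => ∅, monotone_const, fun _ => ⟨.empty, Bornology.isBounded_empty⟩,
        fun A _ => ⟨0, fun a _ => h.elim a⟩⟩
    · refine ⟨fun n => Metric.closedBall x n,
        fun m n h => Metric.closedBall_subset_closedBall (by exact_mod_cast h),
        fun n => ⟨measurableSet_closedBall, Metric.isBounded_closedBall⟩, fun A hA => ?_⟩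
      obtain ⟨r, hr⟩ := hA.subset_closedBall x
      obtain ⟨n, hn⟩ := exists_nat_ge r
      exact ⟨n, hr.trans (Metric.closedBall_subset_closedBall hn)⟩

theorem exists_exhaustion_prod (X Y : Type*) [MeasurableSpace X] [Bornology X]
    [MeasurableSpace Y] [Bornology Y] [CountablyExhausted X] [CountablyExhausted Y] :
    ∃ (K : ℕ → Set X) (L : ℕ → Set Y), Monotone K ∧ Monotone L ∧ (∀ n, IsBoundedBorel (K n)) ∧
      (∀ n, IsBoundedBorel (L n)) ∧
      (∀ A B, Bornology.IsBounded A → Bornology.IsBounded B → ∃ n, A ⊆ K n ∧ B ⊆ L n) ∧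
      ∀ A : Set (X × Y), Bornology.IsBounded A → ∃ n, A ⊆ K n ×ˢ L n := by
  obtain ⟨K, hKm, hK, hK'⟩ := CountablyExhausted.exists_exhaustion (X := X)
  obtain ⟨L, hLm, hL, hL'⟩ := CountablyExhausted.exists_exhaustion (X := Y)
  have h : ∀ A B, Bornology.IsBounded A → Bornology.IsBounded B → ∃ n, A ⊆ K n ∧ B ⊆ L n := by
    intro A B hA hB
    obtain ⟨n, hn⟩ := hK' _ hA
    obtain ⟨m, hm⟩ := hL' _ hB
    exact ⟨max n m, hn.trans (hKm (le_max_left n m)), hm.trans (hLm (le_max_right n m))⟩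
  refine ⟨K, L, hKm, hLm, hK, hL, h, fun A hA => ?_⟩
  obtain ⟨n, hn, hn'⟩ := h _ _ hA.image_fst hA.image_snd
  exact ⟨n, fun z hz => ⟨hn ⟨z, hz, rfl⟩, hn' ⟨z, hz, rfl⟩⟩⟩

instance {X Y : Type*} [MeasurableSpace X] [Bornology X] [MeasurableSpace Y] [Bornology Y]
    [CountablyExhausted X] [CountablyExhausted Y] : CountablyExhausted (X × Y) where
  exists_exhaustion := by
    obtain ⟨K, L, hKm, hLm, hK, hL, -, h⟩ := exists_exhaustion_prod X Y
    exact ⟨fun n => K n ×ˢ L n, fun m n h => Set.prod_mono (hKm h) (hLm h),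
      fun n => (hK n).prod (hL n), h⟩

theorem MeasureTheory.VectorMeasure.ext_prod {X Y V : Type*} [MeasurableSpace X]
    [MeasurableSpace Y] [AddCommGroup V] [TopologicalSpace V] [T2Space V]
    {μ ν : VectorMeasure (X × Y) V}
    (h : ∀ A B, MeasurableSet A → MeasurableSet B → μ (A ×ˢ B) = ν (A ×ˢ B)) : μ = ν := by
  refine VectorMeasure.ext_of_generateFrom _ ?_ generateFrom_prod.symm isPiSystem_prod ?_
  · rintro - ⟨A, hA, B, hB, rfl⟩
    exact h A B hA hB
  · rw [← Set.univ_prod_univ]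
    exact h _ _ .univ .univ

/-! ### Local vector measures: restriction, images, uniqueness -/

namespace LocalVectorMeasure

section Basic

variable {X : Type*} [MeasurableSpace X] [Bornology X] {V : Type*}

theorem add_apply [AddCommMonoid V] [TopologicalSpace V] [ContinuousAdd V]
    (μ ν : LocalVectorMeasure X V) (A : Set X) : (μ + ν) A = μ A + ν A := rfl

theorem eq_of_forall [AddCommMonoid V] [TopologicalSpace V] {μ ν : LocalVectorMeasure X V}
    (h : ∀ A, IsBoundedBorel A → μ A = ν A) : μ = ν := by
  ext A
  by_cases hA : IsBoundedBorel A
  · exact h A hA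
  · rw [μ.eq_zero_of_not' A hA, ν.eq_zero_of_not' A hA]

variable [AddCommGroup V] [TopologicalSpace V] [IsTopologicalAddGroup V] [T2Space V]

theorem apply_empty (μ : LocalVectorMeasure X V) : μ ∅ = 0 := by
  -- The constant family `μ ∅` is summable, so its terms tend to `0`.
  have h := μ.hasSum_iUnion' (fun _ => ∅)
    (fun _ => ⟨.empty, Bornology.isBounded_empty⟩) (by simp) (by intro i j _; simp [Function.onFun])
  have := h.summable.tendsto_atTop_zero
  exact tendsto_nhds_unique tendsto_const_nhds this

open scoped Classical in
/-- The vector measure `A ↦ μ (A ∩ K)`, for a bounded Borel set `K`. -/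
noncomputable def restrict (μ : LocalVectorMeasure X V) {K : Set X} (hK : IsBoundedBorel K) :
    VectorMeasure X V where
  measureOf' A := if MeasurableSet A then μ (A ∩ K) else 0
  empty' := by simp [apply_empty]
  not_measurable' A hA := by simp [hA]
  m_iUnion' A hA hd := by
    have h := μ.hasSum_iUnion' (fun n => A n ∩ K) (fun n => hK.inter_left (hA n))
      (by rw [← Set.iUnion_inter]; exact hK.2.subset Set.inter_subset_right)
      (fun i j hij => (hd hij).mono Set.inter_subset_left Set.inter_subset_left)
    rw [← Set.iUnion_inter] at h
    simpa [hA, MeasurableSet.iUnion hA] using h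

theorem restrict_apply (μ : LocalVectorMeasure X V) {K A : Set X} (hK : IsBoundedBorel K)
    (hA : MeasurableSet A) : μ.restrict hK A = μ (A ∩ K) := by
  simp [restrict, hA]

end Basic

section Comap

variable {X : Type*} [MeasurableSpace X] [Bornology X] {Y : Type*} [MeasurableSpace Y] [Bornology Y]
  {V : Type*} [AddCommMonoid V] [TopologicalSpace V]

open scoped Classical in
/-- The local vector measure `A ↦ μ (g A)`, for a map `g` of sets that preserves bounded Borel sets,
disjointness and countable unions. -/
noncomputable def comapSet (μ : LocalVectorMeasure Y V) (g : Set X → Set Y)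
    (hg : ∀ A, IsBoundedBorel A → IsBoundedBorel (g A))
    (hgU : ∀ A : ℕ → Set X, g (⋃ n, A n) = ⋃ n, g (A n))
    (hgd : ∀ A B, Disjoint A B → Disjoint (g A) (g B)) : LocalVectorMeasure X V where
  toFun A := if IsBoundedBorel A then μ (g A) else 0
  eq_zero_of_not' A hA := by simp [hA]
  hasSum_iUnion' A hA hU hd := by
    have hU' : IsBoundedBorel (⋃ n, A n) := ⟨.iUnion fun n => (hA n).1, hU⟩
    simp only [hA, hU', if_true, hgU]
    refine μ.hasSum_iUnion' _ (fun n => hg _ (hA n)) ?_ (fun i j hij => hgd _ _ (hd hij))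
    rw [← hgU]
    exact (hg _ hU').2

/-- The section `A ↦ μ (A × B)` of a local vector measure on a product. -/
noncomputable def sectionLeft (μ : LocalVectorMeasure (X × Y) V) {B : Set Y}
    (hB : IsBoundedBorel B) : LocalVectorMeasure X V :=
  μ.comapSet (fun A => A ×ˢ B) (fun _ hA => hA.prod hB) (fun _ => Set.iUnion_prod_const)
    (fun _ _ h => Set.Disjoint.set_prod_left h _ _)

/-- The section `B ↦ μ (A × B)` of a local vector measure on a product. -/
noncomputable def sectionRight (μ : LocalVectorMeasure (X × Y) V) {A : Set X}
    (hA : IsBoundedBorel A) : LocalVectorMeasure Y V :=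
  μ.comapSet (fun B => A ×ˢ B) (fun _ hB => hA.prod hB) (fun _ => Set.prod_iUnion)
    (fun _ _ h => Set.Disjoint.set_prod_right h _ _)

/-- The image of a local vector measure under a proper measurable map. -/
noncomputable def map (μ : LocalVectorMeasure X V) (φ : X → Y) (hφ : Measurable φ)
    (hφb : ∀ E, Bornology.IsBounded E → Bornology.IsBounded (φ ⁻¹' E)) :
    LocalVectorMeasure Y V :=
  μ.comapSet (fun E => φ ⁻¹' E) (fun _ hE => ⟨hφ hE.1, hφb _ hE.2⟩) (fun _ => Set.preimage_iUnion)
    (fun _ _ h => h.preimage φ)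

theorem sectionLeft_apply (μ : LocalVectorMeasure (X × Y) V) {A : Set X} {B : Set Y}
    (hA : IsBoundedBorel A) (hB : IsBoundedBorel B) : μ.sectionLeft hB A = μ (A ×ˢ B) :=
  if_pos hA

theorem sectionRight_apply (μ : LocalVectorMeasure (X × Y) V) {A : Set X} {B : Set Y}
    (hA : IsBoundedBorel A) (hB : IsBoundedBorel B) : μ.sectionRight hA B = μ (A ×ˢ B) :=
  if_pos hB

theorem map_apply (μ : LocalVectorMeasure X V) {φ : X → Y} (hφ : Measurable φ)
    (hφb : ∀ E, Bornology.IsBounded E → Bornology.IsBounded (φ ⁻¹' E)) {E : Set Y}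
    (hE : IsBoundedBorel E) : μ.map φ hφ hφb E = μ (φ ⁻¹' E) :=
  if_pos hE

end Comap

section Prod

variable {X : Type*} [MeasurableSpace X] [Bornology X] {Y : Type*} [MeasurableSpace Y] [Bornology Y]
  {V : Type*} [AddCommGroup V] [TopologicalSpace V] [IsTopologicalAddGroup V] [T2Space V]

/-- Every bounded set lies in a box of the exhaustion, and restricting to that box reduces the claim
to the π-system of measurable rectangles. -/
theorem ext_prod [CountablyExhausted X] [CountablyExhausted Y]
    {μ ν : LocalVectorMeasure (X × Y) V}
    (h : ∀ A B, IsBoundedBorel A → IsBoundedBorel B → μ (A ×ˢ B) = ν (A ×ˢ B)) : μ = ν := by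
  obtain ⟨K, L, -, -, hK, hL, -, hKL⟩ := exists_exhaustion_prod X Y
  refine eq_of_forall fun E hE => ?_
  obtain ⟨n, hn⟩ := hKL E hE.2
  have key : μ.restrict ((hK n).prod (hL n)) = ν.restrict ((hK n).prod (hL n)) := by
    refine VectorMeasure.ext_prod fun A B hA hB => ?_
    rw [restrict_apply _ _ (hA.prod hB), restrict_apply _ _ (hA.prod hB), Set.prod_inter_prod]
    exact h _ _ ((hK n).inter_left hA) ((hL n).inter_left hB)
  have := congrArg (fun v : VectorMeasure (X × Y) V => v E) key
  simpa [restrict_apply _ _ hE.1, Set.inter_eq_left.2 hn] using this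

/-- Freezing one of the two factors leaves a measure on `X × Y`, to which `ext_prod` applies; this
is done for the second factor, then for the first. -/
theorem ext_prod_prod [CountablyExhausted X] [CountablyExhausted Y]
    {μ ν : LocalVectorMeasure ((X × Y) × (X × Y)) V}
    (h : ∀ A₁ A₂ B₁ B₂, IsBoundedBorel A₁ → IsBoundedBorel A₂ → IsBoundedBorel B₁ →
      IsBoundedBorel B₂ → μ ((A₁ ×ˢ B₁) ×ˢ (A₂ ×ˢ B₂)) = ν ((A₁ ×ˢ B₁) ×ˢ (A₂ ×ˢ B₂))) :
    μ = ν := by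
  have left : ∀ A₁ B₁ F, IsBoundedBorel A₁ → IsBoundedBorel B₁ → IsBoundedBorel F →
      μ ((A₁ ×ˢ B₁) ×ˢ F) = ν ((A₁ ×ˢ B₁) ×ˢ F) := by
    intro A₁ B₁ F hA₁ hB₁ hF
    have hR := hA₁.prod hB₁
    have : μ.sectionRight hR = ν.sectionRight hR := ext_prod fun A₂ B₂ hA₂ hB₂ => by
      rw [sectionRight_apply _ hR (hA₂.prod hB₂), sectionRight_apply _ hR (hA₂.prod hB₂)]
      exact h _ _ _ _ hA₁ hA₂ hB₁ hB₂
    simpa only [sectionRight_apply _ hR hF] using congrArg (fun ρ => toFun ρ F) this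
  refine ext_prod fun E F hE hF => ?_
  have : μ.sectionLeft hF = ν.sectionLeft hF := ext_prod fun A₁ B₁ hA₁ hB₁ => by
    rw [sectionLeft_apply _ (hA₁.prod hB₁) hF, sectionLeft_apply _ (hA₁.prod hB₁) hF]
    exact left _ _ _ hA₁ hB₁ hF
  simpa only [sectionLeft_apply _ hE hF] using congrArg (fun ρ => toFun ρ E) this

end Prod

/-! ### Gluing along an exhaustion -/

section Glue

variable {X : Type*} [MeasurableSpace X] [Bornology X] {Y : Type*} [MeasurableSpace Y] [Bornology Y]
  {V : Type*} [AddCommGroup V] [TopologicalSpace V] [T2Space V]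

/-- A local vector measure on a product is determined by its restrictions to bounded boxes:
if a set function on rectangles extends to a vector measure on every bounded box, then it extends to
a local vector measure. -/
theorem exists_of_forall_bounded [CountablyExhausted X] [CountablyExhausted Y]
    (f : Set X → Set Y → V)
    (h : ∀ K L, IsBoundedBorel K → IsBoundedBorel L → ∃ ρ : VectorMeasure (X × Y) V,
      ∀ A B, MeasurableSet A → MeasurableSet B → ρ (A ×ˢ B) = f (A ∩ K) (B ∩ L)) :
    ∃ ρ : LocalVectorMeasure (X × Y) V,
      ∀ A B, IsBoundedBorel A → IsBoundedBorel B → ρ (A ×ˢ B) = f A B := by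
  classical
  obtain ⟨K, L, hKm, hLm, hK, hL, hAB, hKL⟩ := exists_exhaustion_prod X Y
  choose ρ hρ using fun n => h (K n) (L n) (hK n) (hL n)
  -- On the smaller box both extensions agree on rectangles, hence everywhere. The value at `E`
  -- therefore does not depend on the box chosen to contain `E`.
  have compat : ∀ n m E, n ≤ m → MeasurableSet E → E ⊆ K n ×ˢ L n → ρ n E = ρ m E := by
    intro n m E hnm hE hEn
    have hbox := ((hK n).prod (hL n)).1
    have key : (ρ n).restrict (K n ×ˢ L n) = (ρ m).restrict (K n ×ˢ L n) := by
      refine VectorMeasure.ext_prod fun A B hA hB => ?_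
      rw [VectorMeasure.restrict_apply _ hbox (hA.prod hB),
        VectorMeasure.restrict_apply _ hbox (hA.prod hB), Set.prod_inter_prod,
        hρ n _ _ (hA.inter (hK n).1) (hB.inter (hL n).1),
        hρ m _ _ (hA.inter (hK n).1) (hB.inter (hL n).1)]
      rw [Set.inter_assoc, Set.inter_assoc, Set.inter_assoc, Set.inter_assoc, Set.inter_self,
        Set.inter_self, Set.inter_eq_left.2 (hKm hnm), Set.inter_eq_left.2 (hLm hnm)]
    have := congrArg (fun v : VectorMeasure (X × Y) V => v E) key
    simpa [VectorMeasure.restrict_apply _ hbox hE, Set.inter_eq_left.2 hEn] using this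
  have compat' : ∀ n m E, MeasurableSet E → E ⊆ K n ×ˢ L n → E ⊆ K m ×ˢ L m →
      ρ n E = ρ m E := by
    intro n m E hE hn hm
    rcases le_total n m with h | h
    · exact compat n m E h hE hn
    · exact (compat m n E h hE hm).symm
  have hval : ∀ (E : Set (X × Y)) (hE : IsBoundedBorel E) (n : ℕ), E ⊆ K n ×ˢ L n →
      (if hE : IsBoundedBorel E then ρ (hKL E hE.2).choose E else 0) = ρ n E := by
    intro E hE n hn
    rw [dif_pos hE]
    exact compat' _ _ _ hE.1 (hKL E hE.2).choose_spec hn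
  refine ⟨⟨fun E => if hE : IsBoundedBorel E then ρ (hKL E hE.2).choose E else 0,
    fun A hA => dif_neg hA, fun A hA hU hd => ?_⟩, fun A B hA hB => ?_⟩
  · obtain ⟨n, hn⟩ := hKL _ hU
    rw [hval _ ⟨.iUnion fun n => (hA n).1, hU⟩ n hn]
    have : ∀ k, (if hE : IsBoundedBorel (A k) then ρ (hKL (A k) hE.2).choose (A k) else 0)
        = ρ n (A k) := fun k => hval _ (hA k) n ((Set.subset_iUnion A k).trans hn)
    simp only [this]
    exact (ρ n).m_iUnion (fun k => (hA k).1) hd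
  · obtain ⟨n, hnA, hnB⟩ := hAB A B hA.2 hB.2
    refine (hval _ (hA.prod hB) n (Set.prod_mono hnA hnB)).trans ?_
    rw [hρ n A B hA.1 hB.1, Set.inter_eq_left.2 hnA, Set.inter_eq_left.2 hnB]

end Glue

end LocalVectorMeasure

/-! ### Products of real measures and permutation of coordinates -/

namespace MeasureTheory.SignedMeasure

variable {X Y : Type*} [MeasurableSpace X] [MeasurableSpace Y]

/-- After a Jordan splitting of `s`, each part is a finite positive measure, equal to its own
variation, so finiteness of the variation is immediate. The second factor needs no splitting. -/
theorem exists_prod (s : SignedMeasure X) (t : SignedMeasure Y) :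
    ∃ ρ : SignedMeasure (X × Y), ∀ A B, MeasurableSet A → MeasurableSet B →
      ρ (A ×ˢ B) = s A * t B := by
  set j := s.toJordanDecomposition with hj
  have hp : IsFiniteMeasure j.posPart.toSignedMeasure.variation := by
    rw [Measure.variation_toSignedMeasure]; infer_instance
  have hq : IsFiniteMeasure j.negPart.toSignedMeasure.variation := by
    rw [Measure.variation_toSignedMeasure]; infer_instance
  refine ⟨j.posPart.toSignedMeasure.prod t (ContinuousLinearMap.mul ℝ ℝ) -
    j.negPart.toSignedMeasure.prod t (ContinuousLinearMap.mul ℝ ℝ), fun A B hA hB => ?_⟩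
  conv_rhs => rw [← s.toSignedMeasure_toJordanDecomposition, ← hj]
  simp [JordanDecomposition.toSignedMeasure, sub_mul]

end MeasureTheory.SignedMeasure

namespace LocalVectorMeasure

variable {X : Type*} [MeasurableSpace X] [Bornology X] {Y : Type*} [MeasurableSpace Y] [Bornology Y]

/-- The multiple `c • μ` of a real measure. -/
def constMul (c : ℝ) (μ : RealMeasure X) : RealMeasure X where
  toFun A := c * μ A
  eq_zero_of_not' A hA := by rw [μ.eq_zero_of_not' A hA, mul_zero]
  hasSum_iUnion' A hA hU hd := (μ.hasSum_iUnion' A hA hU hd).mul_left c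

theorem constMul_apply (c : ℝ) (μ : RealMeasure X) (A : Set X) : constMul c μ A = c * μ A := rfl

theorem exists_prod [CountablyExhausted X] [CountablyExhausted Y]
    (μ : RealMeasure X) (ν : RealMeasure Y) :
    ∃ ρ : RealMeasure (X × Y), ∀ A B, IsBoundedBorel A → IsBoundedBorel B →
      ρ (A ×ˢ B) = μ A * ν B := by
  refine exists_of_forall_bounded (fun A B => μ A * ν B) fun K L hK hL => ?_
  obtain ⟨ρ, hρ⟩ := SignedMeasure.exists_prod (μ.restrict hK) (ν.restrict hL)
  refine ⟨ρ, fun A B hA hB => ?_⟩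
  rw [hρ A B hA hB, restrict_apply _ _ hA, restrict_apply _ _ hB]

/-- The product of two real measures. -/
noncomputable def prod [CountablyExhausted X] [CountablyExhausted Y]
    (μ : RealMeasure X) (ν : RealMeasure Y) : RealMeasure (X × Y) :=
  (exists_prod μ ν).choose

theorem prod_apply [CountablyExhausted X] [CountablyExhausted Y]
    (μ : RealMeasure X) (ν : RealMeasure Y) {A : Set X} {B : Set Y} (hA : IsBoundedBorel A)
    (hB : IsBoundedBorel B) : μ.prod ν (A ×ˢ B) = μ A * ν B :=
  (exists_prod μ ν).choose_spec A B hA hB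

/-- The image of `C₁ ⊗ C₂` under the exchange of the two middle coordinates. -/
theorem exists_isReorderedProduct [CountablyExhausted X] [CountablyExhausted Y]
    (C₁ : RealMeasure (X × X)) (C₂ : RealMeasure (Y × Y)) :
    ∃ T : RealMeasure ((X × Y) × (X × Y)), IsReorderedProduct C₁ C₂ T := by
  let φ : (X × X) × (Y × Y) → (X × Y) × (X × Y) := fun z => ((z.1.1, z.2.1), (z.1.2, z.2.2))
  have hφ : Measurable φ := by fun_prop
  -- The preimage lies in the product of the four coordinate projections of `E`, each of which is
  -- bounded.
  have hφb : ∀ E, Bornology.IsBounded E → Bornology.IsBounded (φ ⁻¹' E) := by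
    intro E hE
    refine (((hE.image_fst.image_fst.prod hE.image_snd.image_fst).prod
      (hE.image_fst.image_snd.prod hE.image_snd.image_snd))).subset fun z hz => ?_
    exact ⟨⟨⟨_, ⟨_, hz, rfl⟩, rfl⟩, ⟨_, ⟨_, hz, rfl⟩, rfl⟩⟩,
      ⟨⟨_, ⟨_, hz, rfl⟩, rfl⟩, ⟨_, ⟨_, hz, rfl⟩, rfl⟩⟩⟩
  refine ⟨(C₁.prod C₂).map φ hφ hφb, fun A₁ A₂ B₁ B₂ hA₁ hA₂ hB₁ hB₂ => ?_⟩
  rw [map_apply _ _ _ ((hA₁.prod hB₁).prod (hA₂.prod hB₂)),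
    ← prod_apply C₁ C₂ (hA₁.prod hA₂) (hB₁.prod hB₂)]
  congr 1
  ext z
  simp only [φ, Set.mem_preimage, Set.mem_prod]
  tauto

/-- The image of `C ⊗ C` under the exchange of the two `Y`-coordinates. -/
theorem exists_isCrossedProduct [CountablyExhausted X] [CountablyExhausted Y]
    (C : RealMeasure (X × Y)) :
    ∃ T : RealMeasure ((X × Y) × (X × Y)), IsCrossedProduct C T := by
  let φ : (X × Y) × (X × Y) → (X × Y) × (X × Y) := fun z => ((z.1.1, z.2.2), (z.2.1, z.1.2))
  have hφ : Measurable φ := by fun_prop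
  have hφb : ∀ E, Bornology.IsBounded E → Bornology.IsBounded (φ ⁻¹' E) := by
    intro E hE
    refine (((hE.image_fst.image_fst.prod hE.image_snd.image_snd).prod
      (hE.image_snd.image_fst.prod hE.image_fst.image_snd))).subset fun z hz => ?_
    exact ⟨⟨⟨_, ⟨_, hz, rfl⟩, rfl⟩, ⟨_, ⟨_, hz, rfl⟩, rfl⟩⟩,
      ⟨⟨_, ⟨_, hz, rfl⟩, rfl⟩, ⟨_, ⟨_, hz, rfl⟩, rfl⟩⟩⟩
  refine ⟨(C.prod C).map φ hφ hφb, fun A₁ A₂ B₁ B₂ hA₁ hA₂ hB₁ hB₂ => ?_⟩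
  rw [map_apply _ _ _ ((hA₁.prod hB₁).prod (hA₂.prod hB₂)),
    ← prod_apply C C (hA₁.prod hB₂) (hA₂.prod hB₁)]
  congr 1
  ext z
  simp only [φ, Set.mem_preimage, Set.mem_prod]
  tauto

end LocalVectorMeasure

/-! ### Gaussian fourth moments and the Isserlis formula -/

namespace ProbabilityTheory

theorem integral_pow_four_gaussianReal (m : ℝ) (v : NNReal) :
    ∫ x, x ^ 4 ∂(gaussianReal m v) = m ^ 4 + 6 * m ^ 2 * v + 3 * (v : ℝ) ^ 2 := by
  -- With `u = m + v t`, differentiating `q` times the moment generating function replaces `q` by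
  -- `q' + q u`. Four such steps from `q = 1`, evaluated at `t = 0`, give the moment.
  have hd : ∀ (q q' : ℝ → ℝ), (∀ t, HasDerivAt q (q' t) t) →
      deriv (fun t => q t * Real.exp (m * t + v * t ^ 2 / 2)) =
        fun t => (q' t + q t * (m + v * t)) * Real.exp (m * t + v * t ^ 2 / 2) := by
    intro q q' hq
    ext t
    have he : HasDerivAt (fun t : ℝ => m * t + (v : ℝ) * t ^ 2 / 2) (m + v * t) t := by
      have := ((hasDerivAt_id t).const_mul m).add
        ((((hasDerivAt_id t).pow 2).const_mul (v : ℝ)).div_const 2)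
      refine this.congr_deriv ?_
      simp
      ring
    refine ((hq t).fun_mul he.exp).deriv.trans ?_
    ring
  have hu : ∀ t, HasDerivAt (fun t : ℝ => m + v * t) v t := fun t => by
    simpa using ((hasDerivAt_id t).const_mul (v : ℝ)).const_add m
  have h4 : ∫ x, x ^ 4 ∂(gaussianReal m v)
      = iteratedDeriv 4 (mgf (fun x ↦ x) (gaussianReal m v)) 0 := by
    rw [iteratedDeriv_mgf_zero] <;> simp
  have h0 : mgf (fun x ↦ x) (gaussianReal m v)
      = fun t => (1 : ℝ) * Real.exp (m * t + v * t ^ 2 / 2) := by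
    rw [mgf_fun_id_gaussianReal]; simp
  rw [h4, h0, iteratedDeriv_succ', iteratedDeriv_succ', iteratedDeriv_succ', iteratedDeriv_one,
    hd (fun _ => 1) (fun _ => 0) (fun t => hasDerivAt_const t _),
    hd _ (fun _ => v) (fun t => ?_), hd _ (fun t => 2 * (m + v * t) * v) (fun t => ?_),
    hd _ (fun t => 3 * v ^ 2 + 3 * (m + v * t) ^ 2 * v) (fun t => ?_)]
  · simp
    ring
  · simp only [zero_add, one_mul]
    refine ((((hu t).const_mul 2).mul_const (v : ℝ)).fun_add
      ((((hu t).fun_mul (hu t)).const_add (v : ℝ)).fun_mul (hu t))).congr_deriv ?_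
    ring
  · simp only [zero_add, one_mul]
    refine (((hu t).fun_mul (hu t)).const_add (v : ℝ)).congr_deriv ?_
    ring
  · simpa only [zero_add, one_mul] using hu t

/-- The fourth moment of a real Gaussian random variable, in terms of the first two. -/
theorem HasGaussianLaw.integral_pow_four {Ω : Type*} [MeasurableSpace Ω] {P : Measure Ω}
    {X : Ω → ℝ} (hX : HasGaussianLaw X P) :
    ∫ ω, X ω ^ 4 ∂P = 3 * (∫ ω, X ω ^ 2 ∂P) ^ 2 - 2 * (∫ ω, X ω ∂P) ^ 4 := by
  have := hX.isProbabilityMeasure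
  have h := hX.map_eq_gaussianReal
  have h4 : ∫ ω, X ω ^ 4 ∂P = ∫ x, x ^ 4 ∂(P.map X) := by
    rw [integral_map hX.aemeasurable (by fun_prop)]
  have hv := variance_eq_sub hX.memLp_two
  rw [h4, h, integral_pow_four_gaussianReal, Real.coe_toNNReal _ (variance_nonneg X P), hv]
  simp only [Pi.pow_apply]
  ring

/-- The linear combinations of a Gaussian process are Gaussian. -/
theorem IsGaussianProcess.hasGaussianLaw_linearCombination {Ω T ι : Type*} [MeasurableSpace Ω]
    [Fintype ι] {P : Measure Ω} {X : T → Ω → ℝ} (hX : IsGaussianProcess X P) (t : ι → T)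
    (c : ι → ℝ) : HasGaussianLaw (fun ω => ∑ i, c i * X (t i) ω) P := by
  simpa using! ((hX.comp_right t).smul c).hasGaussianLaw_fun_sum (I := Finset.univ)

theorem IsGaussianProcess.memLp_mul {Ω T : Type*} [MeasurableSpace Ω] {P : Measure Ω}
    {X : T → Ω → ℝ} (hX : IsGaussianProcess X P) (s t : T) :
    MemLp (fun ω => X s ω * X t ω) 2 P := by
  have hL : ∀ t, MemLp (X t) 4 P := fun t => (hX.hasGaussianLaw_eval t).memLp (by simp)
  have : ENNReal.HolderTriple 4 4 2 := ⟨by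
    rw [← ENNReal.toReal_eq_toReal_iff' (by simp) (by simp), ENNReal.toReal_add (by simp) (by simp)]
    norm_num⟩
  exact (hL t).mul' (hL s)

/-- The Isserlis formula for the mixed moment of four jointly Gaussian, not necessarily centred,
random variables. -/
theorem IsGaussianProcess.integral_mul_mul_mul {Ω T : Type*} [MeasurableSpace Ω] {P : Measure Ω}
    {X : T → Ω → ℝ} (hX : IsGaussianProcess X P) (a b c d : T) :
    ∫ ω, X a ω * X b ω * (X c ω * X d ω) ∂P =
      (∫ ω, X a ω * X b ω ∂P) * (∫ ω, X c ω * X d ω ∂P)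
      + (∫ ω, X a ω * X c ω ∂P) * (∫ ω, X b ω * X d ω ∂P)
      + (∫ ω, X a ω * X d ω ∂P) * (∫ ω, X c ω * X b ω ∂P)
      - 2 * ((∫ ω, X a ω ∂P) * (∫ ω, X b ω ∂P) * ((∫ ω, X c ω ∂P) * (∫ ω, X d ω ∂P))) := by
  have := hX.isProbabilityMeasure
  have i1 : ∀ t, Integrable (X t) P := fun t => (hX.hasGaussianLaw_eval t).integrable
  have i2 : ∀ s t, Integrable (fun ω => X s ω * X t ω) P := fun s t =>
    (hX.memLp_mul s t).integrable (by simp)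
  let t : Fin 4 → T := ![a, b, c, d]
  let m : T → ℝ := fun s => ∫ ω, X s ω ∂P
  let G : T → T → ℝ := fun s t => ∫ ω, X s ω * X t ω ∂P
  have hG : ∀ s t, G s t = G t s := fun s t => by simp only [G, mul_comm]
  have mean : ∀ k : Fin 4 → ℝ, ∫ ω, ∑ i, k i * X (t i) ω ∂P = ∑ i, k i * m (t i) := fun k => by
    rw [integral_finsetSum _ fun i _ => (i1 _).const_mul _]
    simp only [integral_const_mul, m]
  have second : ∀ k : Fin 4 → ℝ, ∫ ω, (∑ i, k i * X (t i) ω) ^ 2 ∂P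
      = ∑ i, ∑ j, k i * k j * G (t i) (t j) := fun k => by
    have : ∀ ω, (∑ i, k i * X (t i) ω) ^ 2
        = ∑ i, ∑ j, k i * k j * (X (t i) ω * X (t j) ω) := fun ω => by
      rw [sq, Finset.sum_mul_sum]
      exact Finset.sum_congr rfl fun i _ => Finset.sum_congr rfl fun j _ => by ring
    simp only [this]
    rw [integral_finsetSum _ fun i _ => integrable_finsetSum _ fun j _ => (i2 _ _).const_mul _]
    refine Finset.sum_congr rfl fun i _ => ?_
    rw [integral_finsetSum _ fun j _ => (i2 _ _).const_mul _]
    simp only [integral_const_mul, G]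
  -- Every linear combination is Gaussian, so its fourth moment is determined by the means `m` and
  -- the second moments `G`.
  have fourth : ∀ k : Fin 4 → ℝ, ∫ ω, (∑ i, k i * X (t i) ω) ^ 4 ∂P
      = 3 * (∑ i, ∑ j, k i * k j * G (t i) (t j)) ^ 2 - 2 * (∑ i, k i * m (t i)) ^ 4 := fun k => by
    rw [(hX.hasGaussianLaw_linearCombination t k).integral_pow_four, second, mean]
  have i4 : ∀ k : Fin 4 → ℝ, Integrable (fun ω => (∑ i, k i * X (t i) ω) ^ 4) P := fun k => by
    have h := ((hX.hasGaussianLaw_linearCombination t k).memLp (p := 4) (by simp)).integrable_norm_pow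
      (by simp)
    refine h.congr (.of_forall fun ω => ?_)
    simp [Even.pow_abs (show Even 4 by decide)]
  let k : Fin 2 × Fin 2 × Fin 2 → Fin 4 → ℝ := fun e =>
    ![1, (-1) ^ (e.1 : ℕ), (-1) ^ (e.2.1 : ℕ), (-1) ^ (e.2.2 : ℕ)]
  -- Polarization: averaging against the three signs keeps only monomials of odd degree in each of
  -- the last three variables, that is `abcd`. Its coefficient is `4! = 24` for each of the `8` sign
  -- choices, and `8 * 24 = 192`.
  have polar : ∀ ω, X a ω * X b ω * (X c ω * X d ω) = 192⁻¹ * ∑ e : Fin 2 × Fin 2 × Fin 2,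
      k e 1 * k e 2 * k e 3 * (∑ i, k e i * X (t i) ω) ^ 4 := fun ω => by
    simp [Fintype.sum_prod_type, Fin.sum_univ_two, Fin.sum_univ_four, k, t]
    ring
  simp only [polar]
  rw [integral_const_mul, integral_finsetSum _ fun e _ => (i4 _).const_mul _]
  simp only [integral_const_mul, fourth]
  change _ = G a b * G c d + G a c * G b d + G a d * G c b - 2 * (m a * m b * (m c * m d))
  simp [Fintype.sum_prod_type, Fin.sum_univ_two, Fin.sum_univ_four, k, t]
  rw [hG b a, hG c a, hG d a, hG c b, hG d b, hG d c]
  ring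

end ProbabilityTheory

/-! ### Extending a Hilbert-valued set function from its Gram matrix -/

namespace MeasureTheory

variable {Z : Type*} [MeasurableSpace Z]

open scoped Classical in
/-- The vector measure `E ↦ 1_E` with values in `L²(ν)`. -/
noncomputable def indicatorVectorMeasure (ν : Measure Z) [IsFiniteMeasure ν] :
    VectorMeasure Z (Lp ℝ 2 ν) where
  measureOf' E := if h : MeasurableSet E then indicatorConstLp 2 h (measure_ne_top ν E) 1 else 0
  empty' := by simp
  not_measurable' E hE := by simp [hE]
  m_iUnion' A hA hd := by
    have hU : MeasurableSet (⋃ n, A n) := .iUnion hA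
    have hS : ∀ S : Finset ℕ, MeasurableSet (⋃ n ∈ S, A n) := fun S =>
      S.measurableSet_biUnion fun n _ => hA n
    have hsum : ∀ S : Finset ℕ, ∑ n ∈ S, indicatorConstLp 2 (hA n) (measure_ne_top ν (A n)) (1 : ℝ)
        = indicatorConstLp 2 (hS S) (measure_ne_top ν _) 1 := by
      intro S
      induction S using Finset.induction_on with
      | empty => simp
      | insert a S ha ih =>
        rw [Finset.sum_insert ha, ih, ← indicatorConstLp_disjoint_union (hA a) (hS S)]
        · congr 1
          simp
        · simp only [Set.disjoint_iUnion_right]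
          exact fun n hn => hd (by rintro rfl; exact ha hn)
    simp only [hA, hU, dif_pos, HasSum, hsum]
    -- Convergence in `L²` reduces to the measure of the symmetric difference, which is the tail of
    -- the convergent series `∑ ν (A n)`.
    refine tendsto_indicatorConstLp_set (by simp) ?_
    have h1 : ∀ S : Finset ℕ, ν (symmDiff (⋃ n ∈ S, A n) (⋃ n, A n))
        = ν (⋃ n, A n) - ∑ n ∈ S, ν (A n) := fun S => by
      have hsub : (⋃ n ∈ S, A n) ⊆ ⋃ n, A n := Set.iUnion₂_subset_iUnion _ _
      rw [symmDiff_of_le hsub, measure_sdiff hsub (hS S).nullMeasurableSet (measure_ne_top _ _),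
        measure_biUnion_finset (fun i _ j _ hij => hd hij) fun n _ => hA n]
    simp only [h1]
    have h2 : HasSum (fun n => ν (A n)) (ν (⋃ n, A n)) := by
      rw [measure_iUnion hd hA]; exact ENNReal.summable.hasSum
    simpa using! ENNReal.Tendsto.sub tendsto_const_nhds h2 (.inl (measure_ne_top ν (⋃ n, A n)))

theorem indicatorVectorMeasure_apply (ν : Measure Z) [IsFiniteMeasure ν] {E : Set Z}
    (hE : MeasurableSet E) :
    indicatorVectorMeasure ν E = indicatorConstLp 2 hE (measure_ne_top ν E) 1 := by
  simp [indicatorVectorMeasure, hE]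

theorem inner_indicatorVectorMeasure (ν : Measure Z) [IsFiniteMeasure ν] {E F : Set Z}
    (hE : MeasurableSet E) (hF : MeasurableSet F) :
    inner ℝ (indicatorVectorMeasure ν E) (indicatorVectorMeasure ν F) = ν.real (E ∩ F) := by
  rw [indicatorVectorMeasure_apply ν hE, indicatorVectorMeasure_apply ν hF,
    L2.real_inner_indicatorConstLp_one_indicatorConstLp_one]

/-- By the π-λ argument the closed span contains the indicators of all measurable sets; complements
are reached because the constant `1` is among the generators. Simple functions, and then all of
`L²`, follow. -/
theorem dense_span_indicatorVectorMeasure (ν : Measure Z) [IsFiniteMeasure ν] {ι : Type*}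
    {R : ι → Set Z} (hgen : ‹MeasurableSpace Z› = MeasurableSpace.generateFrom (Set.range R))
    (hpi : IsPiSystem (Set.range R)) (huniv : Set.univ ∈ Set.range R) :
    DenseRange (Finsupp.linearCombination ℝ fun i => indicatorVectorMeasure ν (R i)) := by
  set J := Finsupp.linearCombination ℝ fun i => indicatorVectorMeasure ν (R i) with hJ
  let W := (LinearMap.range J).topologicalClosure
  have hR : ∀ i, indicatorVectorMeasure ν (R i) ∈ W := fun i =>
    Submodule.le_topologicalClosure _ ⟨Finsupp.single i 1, by simp [hJ]⟩
  have hset : ∀ E, MeasurableSet E → indicatorVectorMeasure ν E ∈ W := by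
    intro E hE
    induction E, hE using MeasurableSpace.induction_on_inter hgen hpi with
    | empty => simp
    | basic t ht => obtain ⟨i, rfl⟩ := ht; exact hR i
    | compl t ht ih =>
      obtain ⟨i, hi⟩ := huniv
      rw [VectorMeasure.of_compl ht]
      exact W.sub_mem (hi ▸ hR i) ih
    | iUnion f hd hm ih =>
      refine IsClosed.mem_of_tendsto (Submodule.isClosed_topologicalClosure _)
        ((indicatorVectorMeasure ν).m_iUnion hm hd) (.of_forall fun S => ?_)
      exact W.sum_mem fun i _ => ih i
  have hall : ∀ f : Lp ℝ 2 ν, f ∈ W := by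
    refine Lp.induction (by simp) _ ?_ ?_ (Submodule.isClosed_topologicalClosure _)
    · intro c s hs hμs
      have : (Lp.simpleFunc.indicatorConst 2 hs hμs.ne c : Lp ℝ 2 ν)
          = c • indicatorVectorMeasure ν s := by
        rw [indicatorVectorMeasure_apply ν hs, Lp.simpleFunc.coe_indicatorConst,
          indicatorConstLp_eq_toSpanSingleton_compLp]
        ext1
        filter_upwards [ContinuousLinearMap.coeFn_compLp (ContinuousLinearMap.toSpanSingleton ℝ c)
          (indicatorConstLp 2 hs hμs.ne (1 : ℝ)), Lp.coeFn_smul c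
          (indicatorConstLp 2 hs hμs.ne (1 : ℝ))] with x h1 h2
        simp [h1, h2, mul_comm]
      rw [this]
      exact W.smul_mem c (hset s hs)
    · exact fun f g hf hg _ h1 h2 => W.add_mem h1 h2
  intro f
  have := hall f
  rwa [← SetLike.mem_coe, Submodule.topologicalClosure_coe, LinearMap.coe_range] at this

theorem integral_sum_sum_indicator {ι : Type*} (s : Finset ι) (k : ι → ι → ℝ)
    (S : ι → ι → Set Z) (hS : ∀ i j, MeasurableSet (S i j)) (p : Measure Z) [IsFiniteMeasure p] :
    Integrable (fun z => ∑ i ∈ s, ∑ j ∈ s, k i j * (S i j).indicator (fun _ => (1 : ℝ)) z) p ∧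
    ∫ z, ∑ i ∈ s, ∑ j ∈ s, k i j * (S i j).indicator (fun _ => (1 : ℝ)) z ∂p
      = ∑ i ∈ s, ∑ j ∈ s, k i j * p.real (S i j) := by
  have hi : ∀ i j, Integrable (fun z => k i j * (S i j).indicator (fun _ => (1 : ℝ)) z) p :=
    fun i j => ((integrable_const 1).indicator (hS i j)).const_mul _
  refine ⟨integrable_finsetSum _ fun i _ => integrable_finsetSum _ fun j _ => hi i j, ?_⟩
  rw [integral_finsetSum _ fun i _ => integrable_finsetSum _ fun j _ => hi i j]
  refine Finset.sum_congr rfl fun i _ => ?_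
  rw [integral_finsetSum _ fun j _ => hi i j]
  refine Finset.sum_congr rfl fun j _ => ?_
  rw [integral_const_mul, integral_indicator_const _ (hS i j), smul_eq_mul, mul_one]

/-- The quadratic form of a finite measure on `Z × Z` is dominated by the sum of those of its
marginals. -/
theorem mul_sum_sum_real_prod_le {ι : Type*} (s : Finset ι) (c : ι → ℝ)
    {R : ι → Set Z} (hR : ∀ i, MeasurableSet (R i)) (p : Measure (Z × Z)) [IsFiniteMeasure p]
    {ε : ℝ} (hε : ε ^ 2 = 1) :
    ε * ∑ i ∈ s, ∑ j ∈ s, c i * c j * p.real (R j ×ˢ R i) ≤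
      ∑ i ∈ s, ∑ j ∈ s, c i * c j * (p.fst + p.snd).real (R j ∩ R i) := by
  have h1 := integral_sum_sum_indicator s (fun i j => c i * c j) (fun i j => R j ×ˢ R i)
    (fun i j => (hR j).prod (hR i)) p
  have h2 := integral_sum_sum_indicator s (fun i j => c i * c j)
    (fun i j => Prod.fst ⁻¹' (R j ∩ R i))
    (fun i j => measurable_fst ((hR j).inter (hR i))) p
  have h3 := integral_sum_sum_indicator s (fun i j => c i * c j)
    (fun i j => Prod.snd ⁻¹' (R j ∩ R i))
    (fun i j => measurable_snd ((hR j).inter (hR i))) p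
  have hν : ∀ i j, (p.fst + p.snd).real (R j ∩ R i)
      = p.real (Prod.fst ⁻¹' (R j ∩ R i)) + p.real (Prod.snd ⁻¹' (R j ∩ R i)) := fun i j => by
    have hm := (hR j).inter (hR i)
    rw [measureReal_add_apply]
    simp only [measureReal_def, Measure.fst_apply hm, Measure.snd_apply hm]
  simp only [hν, mul_add, Finset.sum_add_distrib]
  rw [← h1.2, ← h2.2, ← h3.2, ← integral_const_mul, ← integral_add h2.1 h3.1]
  refine integral_mono (h1.1.const_mul ε) (h2.1.add h3.1) fun z => ?_
  -- In terms of the step function `g`, the two sides are `∫ ε g(x) g(y) dp` and `∫ (g(x)² + g(y)²)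
  -- dp`, and they compare pointwise.
  let g : Z → ℝ := fun z => ∑ i ∈ s, c i * (R i).indicator (fun _ => (1 : ℝ)) z
  have e : ∀ x y, g x * g y = ∑ i ∈ s, ∑ j ∈ s, c i * c j *
      ((R i).indicator (fun _ => (1 : ℝ)) x * (R j).indicator (fun _ => (1 : ℝ)) y) := fun x y => by
    simp only [g, Finset.sum_mul_sum]
    exact Finset.sum_congr rfl fun i _ => Finset.sum_congr rfl fun j _ => by ring
  have e1 : ∑ i ∈ s, ∑ j ∈ s, c i * c j * (R j ×ˢ R i).indicator (fun _ => (1 : ℝ)) z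
      = g z.1 * g z.2 := by
    rw [mul_comm, e]
    refine Finset.sum_congr rfl fun i _ => Finset.sum_congr rfl fun j _ => ?_
    by_cases h : z.2 ∈ R i <;> by_cases h' : z.1 ∈ R j <;> simp [Set.indicator, h, h']
  have e2 : ∑ i ∈ s, ∑ j ∈ s, c i * c j *
      (Prod.fst ⁻¹' (R j ∩ R i)).indicator (fun _ => (1 : ℝ)) z = g z.1 * g z.1 := by
    rw [e]
    refine Finset.sum_congr rfl fun i _ => Finset.sum_congr rfl fun j _ => ?_
    by_cases h : z.1 ∈ R i <;> by_cases h' : z.1 ∈ R j <;> simp [Set.indicator, h, h']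
  have e3 : ∑ i ∈ s, ∑ j ∈ s, c i * c j *
      (Prod.snd ⁻¹' (R j ∩ R i)).indicator (fun _ => (1 : ℝ)) z = g z.2 * g z.2 := by
    rw [e]
    refine Finset.sum_congr rfl fun i _ => Finset.sum_congr rfl fun j _ => ?_
    by_cases h : z.2 ∈ R i <;> by_cases h' : z.2 ∈ R j <;> simp [Set.indicator, h, h']
  simp only [e1, e2, e3]
  nlinarith [sq_nonneg (ε * g z.1 - g z.2), sq_nonneg (g z.1), sq_nonneg (g z.2)]

/-- A Hilbert space valued function on a generating `π`-system, whose Gram matrix is given by a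
signed measure on the square of the space, extends to a vector measure. -/
theorem VectorMeasure.exists_of_gram {H : Type*} [NormedAddCommGroup H] [InnerProductSpace ℝ H]
    [CompleteSpace H] {ι : Type*} {R : ι → Set Z}
    (hgen : ‹MeasurableSpace Z› = MeasurableSpace.generateFrom (Set.range R))
    (hpi : IsPiSystem (Set.range R)) (huniv : Set.univ ∈ Set.range R) (f : ι → H)
    (T : SignedMeasure (Z × Z)) (hT : ∀ i j, T (R i ×ˢ R j) = inner ℝ (f i) (f j)) :
    ∃ ρ : VectorMeasure Z H, ∀ i, ρ (R i) = f i := by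
  have hR : ∀ i, MeasurableSet (R i) := fun i => by
    rw [hgen]; exact MeasurableSpace.measurableSet_generateFrom ⟨i, rfl⟩
  let p := T.toJordanDecomposition.posPart
  let q := T.toJordanDecomposition.negPart
  let ν : Measure Z := (p.fst + p.snd) + (q.fst + q.snd)
  have hTpq : ∀ i j, inner ℝ (f i) (f j) = p.real (R i ×ˢ R j) - q.real (R i ×ˢ R j) := by
    intro i j
    rw [← hT]
    conv_lhs => rw [← T.toSignedMeasure_toJordanDecomposition]
    rw [JordanDecomposition.toSignedMeasure, Measure.toSignedMeasure_sub_apply ((hR i).prod (hR j))]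
  let J := Finsupp.linearCombination ℝ fun i => indicatorVectorMeasure ν (R i)
  let I := Finsupp.linearCombination ℝ f
  have hdense : DenseRange J := dense_span_indicatorVectorMeasure ν hgen hpi huniv
  -- This bound makes `I` factor through `J`, although different `c` may give the same step
  -- function. Since the Gram matrix is `p - q`, the domination is used with sign `1` for `p` and
  -- `-1` for `q`.
  have hnorm : ∀ c, ‖I c‖ ≤ 1 * ‖J c‖ := by
    intro c
    rw [one_mul]
    refine le_of_sq_le_sq ?_ (norm_nonneg _)
    rw [← real_inner_self_eq_norm_sq, ← real_inner_self_eq_norm_sq]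
    simp only [I, J, Finsupp.linearCombination_apply, Finsupp.sum, sum_inner, inner_sum,
      real_inner_smul_left, real_inner_smul_right, hTpq, inner_indicatorVectorMeasure ν (hR _) (hR _)]
    have hp := mul_sum_sum_real_prod_le c.support c hR p (ε := 1) (by norm_num)
    have hq := mul_sum_sum_real_prod_le c.support c hR q (ε := -1) (by norm_num)
    have hν : ∀ E, ν.real E = (p.fst + p.snd).real E + (q.fst + q.snd).real E := fun E =>
      measureReal_add_apply
    simp only [hν, ← mul_assoc, mul_add, mul_sub, Finset.sum_add_distrib, Finset.sum_sub_distrib]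
    linarith
  refine ⟨(indicatorVectorMeasure ν).mapRange (I.extendOfNorm J).toLinearMap.toAddMonoidHom
    (I.extendOfNorm J).continuous, fun i => ?_⟩
  have key : I.extendOfNorm J (indicatorVectorMeasure ν (R i)) = f i := by
    simpa [I, J] using LinearMap.extendOfNorm_eq hdense ⟨1, hnorm⟩ (Finsupp.single i 1)
  exact key

end MeasureTheory

/-! ### The tensor product of jointly Gaussian random measures -/

namespace RandomMeasure

variable {Ω : Type*} [MeasurableSpace Ω] {P : Measure Ω}
  {X : Type*} [MeasurableSpace X] [Bornology X] {Y : Type*} [MeasurableSpace Y] [Bornology Y]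

theorem meanMeasure_apply [IsProbabilityMeasure P] (M : RandomMeasure P X) (A : Set X) :
    M.meanMeasure A = ∫ ω, M A ω ∂P := rfl

theorem _root_.MeasureTheory.Lp.covariance_eq_sub [IsProbabilityMeasure P] (f g : Lp ℝ 2 P) :
    cov[f, g; P] = ∫ ω, f ω * g ω ∂P - (∫ ω, f ω ∂P) * ∫ ω, g ω ∂P :=
  ProbabilityTheory.covariance_eq_sub (Lp.memLp f) (Lp.memLp g)

theorem _root_.MeasureTheory.Lp.real_inner_eq_integral (f g : Lp ℝ 2 P) :
    inner ℝ f g = ∫ ω, f ω * g ω ∂P := by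
  rw [L2.inner_def]
  simp [mul_comm]

/-- The real measure `A ↦ ⟪v, μ A⟫`. -/
noncomputable def _root_.LocalVectorMeasure.innerLeft {H : Type*} [NormedAddCommGroup H]
    [InnerProductSpace ℝ H] (v : H) (μ : LocalVectorMeasure X H) : RealMeasure X where
  toFun A := inner ℝ v (μ A)
  eq_zero_of_not' A hA := by rw [μ.eq_zero_of_not' A hA, inner_zero_right]
  hasSum_iUnion' A hA hU hd := (μ.hasSum_iUnion' A hA hU hd).mapL (innerSL ℝ v)

theorem _root_.LocalVectorMeasure.innerLeft_apply {H : Type*} [NormedAddCommGroup H]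
    [InnerProductSpace ℝ H] (v : H) (μ : LocalVectorMeasure X H) (A : Set X) :
    μ.innerLeft v A = inner ℝ v (μ A) := rfl

/-- If the Gram matrix of a Hilbert space valued measure is given on rectangles by a real measure,
then it is given by it on all bounded Borel sets. -/
theorem _root_.LocalVectorMeasure.inner_eq_of_forall_prod [CountablyExhausted X]
    [CountablyExhausted Y] {H : Type*} [NormedAddCommGroup H] [InnerProductSpace ℝ H]
    {μ : LocalVectorMeasure (X × Y) H} {S : RealMeasure ((X × Y) × (X × Y))}
    (h : ∀ A₁ A₂ B₁ B₂, IsBoundedBorel A₁ → IsBoundedBorel A₂ → IsBoundedBorel B₁ →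
      IsBoundedBorel B₂ →
      inner ℝ (μ (A₁ ×ˢ B₁)) (μ (A₂ ×ˢ B₂)) = S ((A₁ ×ˢ B₁) ×ˢ (A₂ ×ˢ B₂)))
    {E F : Set (X × Y)} (hE : IsBoundedBorel E) (hF : IsBoundedBorel F) :
    inner ℝ (μ E) (μ F) = S (E ×ˢ F) := by
  have left : ∀ A₁ B₁ F, IsBoundedBorel A₁ → IsBoundedBorel B₁ → IsBoundedBorel F →
      inner ℝ (μ (A₁ ×ˢ B₁)) (μ F) = S ((A₁ ×ˢ B₁) ×ˢ F) := by
    intro A₁ B₁ F hA₁ hB₁ hF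
    have hR := hA₁.prod hB₁
    have : μ.innerLeft (μ (A₁ ×ˢ B₁)) = S.sectionRight hR :=
      LocalVectorMeasure.ext_prod fun A₂ B₂ hA₂ hB₂ => by
        rw [LocalVectorMeasure.sectionRight_apply _ hR (hA₂.prod hB₂)]
        exact h _ _ _ _ hA₁ hA₂ hB₁ hB₂
    rw [← LocalVectorMeasure.sectionRight_apply _ hR hF, ← this]
    rfl
  have : μ.innerLeft (μ F) = S.sectionLeft hF :=
    LocalVectorMeasure.ext_prod fun A₁ B₁ hA₁ hB₁ => by
      rw [LocalVectorMeasure.sectionLeft_apply _ (hA₁.prod hB₁) hF, ← left _ _ _ hA₁ hB₁ hF,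
        real_inner_comm]
      rfl
  rw [← LocalVectorMeasure.sectionLeft_apply _ hE hF, ← this, real_inner_comm]
  rfl

variable {M₁ : RandomMeasure P X} {M₂ : RandomMeasure P Y}

theorem JointlyGaussian.memLp_mul (h : M₁.JointlyGaussian M₂) {A : Set X} {B : Set Y}
    (hA : IsBoundedBorel A) (hB : IsBoundedBorel B) :
    MemLp (fun ω => M₁ A ω * M₂ B ω) 2 P :=
  IsGaussianProcess.memLp_mul h (Sum.inl ⟨A, hA⟩) (Sum.inr ⟨B, hB⟩)

theorem JointlyGaussian.integral_mul_mul_mul (h : M₁.JointlyGaussian M₂) {A₁ A₂ : Set X}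
    {B₁ B₂ : Set Y} (hA₁ : IsBoundedBorel A₁) (hA₂ : IsBoundedBorel A₂) (hB₁ : IsBoundedBorel B₁)
    (hB₂ : IsBoundedBorel B₂) :
    ∫ ω, M₁ A₁ ω * M₂ B₁ ω * (M₁ A₂ ω * M₂ B₂ ω) ∂P =
      (∫ ω, M₁ A₁ ω * M₂ B₁ ω ∂P) * (∫ ω, M₁ A₂ ω * M₂ B₂ ω ∂P)
      + (∫ ω, M₁ A₁ ω * M₁ A₂ ω ∂P) * (∫ ω, M₂ B₁ ω * M₂ B₂ ω ∂P)
      + (∫ ω, M₁ A₁ ω * M₂ B₂ ω ∂P) * (∫ ω, M₁ A₂ ω * M₂ B₁ ω ∂P)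
      - 2 * ((∫ ω, M₁ A₁ ω ∂P) * (∫ ω, M₂ B₁ ω ∂P) *
        ((∫ ω, M₁ A₂ ω ∂P) * (∫ ω, M₂ B₂ ω ∂P))) :=
  IsGaussianProcess.integral_mul_mul_mul h (Sum.inl ⟨A₁, hA₁⟩) (Sum.inr ⟨B₁, hB₁⟩)
    (Sum.inl ⟨A₂, hA₂⟩) (Sum.inr ⟨B₂, hB₂⟩)

/-- The fourth moments of jointly Gaussian random measures are given by a real measure. -/
theorem JointlyGaussian.exists_moment [IsProbabilityMeasure P] [CountablyExhausted X]
    [CountablyExhausted Y] (h : M₁.JointlyGaussian M₂)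
    {C : RealMeasure (X × Y)} (hC : M₁.IsCrossCovariance M₂ C) :
    ∃ S : RealMeasure ((X × Y) × (X × Y)), ∀ A₁ A₂ B₁ B₂, IsBoundedBorel A₁ → IsBoundedBorel A₂ →
      IsBoundedBorel B₁ → IsBoundedBorel B₂ → S ((A₁ ×ˢ B₁) ×ˢ (A₂ ×ˢ B₂)) =
        ∫ ω, M₁ A₁ ω * M₂ B₁ ω * (M₁ A₂ ω * M₂ B₂ ω) ∂P := by
  let m := M₁.meanMeasure.prod M₂.meanMeasure
  -- The measures are not assumed centred, so the uncentred second moments are recovered as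
  -- covariance plus product of means.
  let G₁ := M₁.covMeasure + M₁.meanMeasure.prod M₁.meanMeasure
  let G₂ := M₂.covMeasure + M₂.meanMeasure.prod M₂.meanMeasure
  let G := C + m
  have hG₁ : ∀ A B, IsBoundedBorel A → IsBoundedBorel B →
      G₁ (A ×ˢ B) = ∫ ω, M₁ A ω * M₁ B ω ∂P := fun A B hA hB => by
    simp only [G₁]
    rw [LocalVectorMeasure.add_apply, M₁.covMeasure_prod hA hB,
      LocalVectorMeasure.prod_apply _ _ hA hB, Lp.covariance_eq_sub, meanMeasure_apply,
      meanMeasure_apply, sub_add_cancel]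
  have hG₂ : ∀ A B, IsBoundedBorel A → IsBoundedBorel B →
      G₂ (A ×ˢ B) = ∫ ω, M₂ A ω * M₂ B ω ∂P := fun A B hA hB => by
    simp only [G₂]
    rw [LocalVectorMeasure.add_apply, M₂.covMeasure_prod hA hB,
      LocalVectorMeasure.prod_apply _ _ hA hB, Lp.covariance_eq_sub, meanMeasure_apply,
      meanMeasure_apply, sub_add_cancel]
  have hG : ∀ A B, IsBoundedBorel A → IsBoundedBorel B →
      G (A ×ˢ B) = ∫ ω, M₁ A ω * M₂ B ω ∂P := fun A B hA hB => by
    simp only [G, m]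
    rw [LocalVectorMeasure.add_apply, ← hC A B hA hB,
      LocalVectorMeasure.prod_apply _ _ hA hB, Lp.covariance_eq_sub, meanMeasure_apply,
      meanMeasure_apply, sub_add_cancel]
  obtain ⟨T, hT⟩ := LocalVectorMeasure.exists_isReorderedProduct G₁ G₂
  obtain ⟨T', hT'⟩ := LocalVectorMeasure.exists_isCrossedProduct G
  -- One summand for each of the three Isserlis pairings, and one for the correction by the means.
  refine ⟨G.prod G + T + T' + LocalVectorMeasure.constMul (-2) (m.prod m),
    fun A₁ A₂ B₁ B₂ hA₁ hA₂ hB₁ hB₂ => ?_⟩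
  rw [h.integral_mul_mul_mul hA₁ hA₂ hB₁ hB₂, LocalVectorMeasure.add_apply,
    LocalVectorMeasure.add_apply, LocalVectorMeasure.add_apply, LocalVectorMeasure.constMul_apply,
    LocalVectorMeasure.prod_apply _ _ (hA₁.prod hB₁) (hA₂.prod hB₂),
    LocalVectorMeasure.prod_apply _ _ (hA₁.prod hB₁) (hA₂.prod hB₂),
    hT _ _ _ _ hA₁ hA₂ hB₁ hB₂, hT' _ _ _ _ hA₁ hA₂ hB₁ hB₂,
    LocalVectorMeasure.prod_apply _ _ hA₁ hB₁, LocalVectorMeasure.prod_apply _ _ hA₂ hB₂,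
    hG _ _ hA₁ hB₁, hG _ _ hA₂ hB₂, hG _ _ hA₁ hB₂, hG _ _ hA₂ hB₁, hG₁ _ _ hA₁ hA₂,
    hG₂ _ _ hB₁ hB₂]
  simp only [meanMeasure_apply]
  ring

theorem JointlyGaussian.exists_isTensorProduct [IsProbabilityMeasure P] [CountablyExhausted X]
    [CountablyExhausted Y] (h : M₁.JointlyGaussian M₂)
    {C : RealMeasure (X × Y)} (hC : M₁.IsCrossCovariance M₂ C) :
    ∃ M : RandomMeasure P (X × Y), M₁.IsTensorProduct M₂ M := by
  classical
  obtain ⟨S, hS⟩ := h.exists_moment hC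
  let f : Set X → Set Y → Lp ℝ 2 P := fun A B =>
    if hAB : IsBoundedBorel A ∧ IsBoundedBorel B then (h.memLp_mul hAB.1 hAB.2).toLp else 0
  have hf : ∀ A B, IsBoundedBorel A → IsBoundedBorel B →
      f A B =ᵐ[P] fun ω => M₁ A ω * M₂ B ω := fun A B hA hB => by
    simp only [f, dif_pos (And.intro hA hB)]
    exact MemLp.coeFn_toLp _
  have hinner : ∀ A₁ A₂ B₁ B₂, IsBoundedBorel A₁ → IsBoundedBorel A₂ → IsBoundedBorel B₁ →
      IsBoundedBorel B₂ → inner ℝ (f A₁ B₁) (f A₂ B₂) = S ((A₁ ×ˢ B₁) ×ˢ (A₂ ×ˢ B₂)) := by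
    intro A₁ A₂ B₁ B₂ hA₁ hA₂ hB₁ hB₂
    rw [hS _ _ _ _ hA₁ hA₂ hB₁ hB₂, Lp.real_inner_eq_integral]
    refine integral_congr_ae ?_
    filter_upwards [hf _ _ hA₁ hB₁, hf _ _ hA₂ hB₂] with ω h1 h2
    rw [h1, h2]
  obtain ⟨μ, hμ⟩ := LocalVectorMeasure.exists_of_forall_bounded f fun K L hK hL => by
    let ι := {A : Set X // MeasurableSet A} × {B : Set Y // MeasurableSet B}
    let R : ι → Set (X × Y) := fun i => i.1.1 ×ˢ i.2.1
    have hrange : Set.range R = Set.image2 (· ×ˢ ·) {s | MeasurableSet s} {t | MeasurableSet t} := by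
      ext E
      constructor
      · rintro ⟨i, rfl⟩
        exact ⟨_, i.1.2, _, i.2.2, rfl⟩
      · rintro ⟨A, hA, B, hB, rfl⟩
        exact ⟨(⟨A, hA⟩, ⟨B, hB⟩), rfl⟩
    have hKL := hK.prod hL
    obtain ⟨ρ, hρ⟩ := VectorMeasure.exists_of_gram (R := R)
      (by rw [hrange]; exact generateFrom_prod.symm) (by rw [hrange]; exact isPiSystem_prod)
      ⟨(⟨Set.univ, .univ⟩, ⟨Set.univ, .univ⟩), Set.univ_prod_univ⟩
      -- Within the box `K × L`, the Gram matrix is given by `S` restricted to the square of the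
      -- box.
      (fun i => f (i.1.1 ∩ K) (i.2.1 ∩ L)) (S.restrict (hKL.prod hKL)) (fun i j => by
        rw [LocalVectorMeasure.restrict_apply _ _ ((i.1.2.prod i.2.2).prod (j.1.2.prod j.2.2)),
          hinner _ _ _ _ (hK.inter_left i.1.2) (hK.inter_left j.1.2) (hL.inter_left i.2.2)
            (hL.inter_left j.2.2), Set.prod_inter_prod, Set.prod_inter_prod, Set.prod_inter_prod])
    exact ⟨ρ, fun A B hA hB => hρ (⟨A, hA⟩, ⟨B, hB⟩)⟩
  have hgram : ∀ E F, IsBoundedBorel E → IsBoundedBorel F → inner ℝ (μ E) (μ F) = S (E ×ˢ F) :=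
    fun E F hE hF => LocalVectorMeasure.inner_eq_of_forall_prod
      (fun A₁ A₂ B₁ B₂ hA₁ hA₂ hB₁ hB₂ => by
        rw [hμ _ _ hA₁ hB₁, hμ _ _ hA₂ hB₂, hinner _ _ _ _ hA₁ hA₂ hB₁ hB₂]) hE hF
  -- The mean is the inner product with the constant `1`, hence a real measure; the covariance
  -- measure is then `S - m ⊗ m`.
  let m : RealMeasure (X × Y) := μ.innerLeft
    (indicatorConstLp 2 MeasurableSet.univ (measure_ne_top P Set.univ) (1 : ℝ))
  have hm : ∀ E, m E = ∫ ω, μ E ω ∂P := fun E => by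
    simp only [m]
    rw [LocalVectorMeasure.innerLeft_apply, L2.inner_indicatorConstLp_one, setIntegral_univ]
  refine ⟨⟨μ, S + LocalVectorMeasure.constMul (-1) (m.prod m), fun E F hE hF => ?_⟩,
    fun A B hA hB => ?_⟩
  · rw [LocalVectorMeasure.add_apply, LocalVectorMeasure.constMul_apply,
      LocalVectorMeasure.prod_apply _ _ hE hF, Lp.covariance_eq_sub, ← Lp.real_inner_eq_integral,
      hgram E F hE hF, hm, hm]
    ring
  · refine Filter.EventuallyEq.trans ?_ (hf A B hA hB)
    rw [← hμ A B hA hB]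

theorem IsTensorProduct.unique [CountablyExhausted X] [CountablyExhausted Y]
    {M M' : RandomMeasure P (X × Y)} (h : M₁.IsTensorProduct M₂ M) (h' : M₁.IsTensorProduct M₂ M') :
    M = M' := by
  have : M.toLocalVectorMeasure = M'.toLocalVectorMeasure :=
    LocalVectorMeasure.ext_prod fun A B hA hB => Lp.ext ((h A B hA hB).trans (h' A B hA hB).symm)
  exact RandomMeasure.ext (congrArg LocalVectorMeasure.toFun this)

theorem IsTensorProduct.meanMeasure_eq [IsProbabilityMeasure P] [CountablyExhausted X]
    [CountablyExhausted Y] {M : RandomMeasure P (X × Y)} (h : M₁.IsTensorProduct M₂ M)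
    {C : RealMeasure (X × Y)} (hC : M₁.IsCrossCovariance M₂ C) (h₁ : M₁.IsCentred) :
    M.meanMeasure = C := by
  refine LocalVectorMeasure.ext_prod fun A B hA hB => ?_
  rw [← hC A B hA hB, Lp.covariance_eq_sub, h₁ A hA, zero_mul, sub_zero, meanMeasure_apply]
  exact integral_congr_ae (h A B hA hB)

/-- With zero means the correction term in the Isserlis formula vanishes. The pairing of each `M₁
Aᵢ` with `M₂ Bᵢ` is the product of the means of `M`, which the covariance subtracts; the other two
pairings are `T` and `T'`. -/
theorem IsTensorProduct.covMeasure_eq [IsProbabilityMeasure P] [CountablyExhausted X]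
    [CountablyExhausted Y] (hG : M₁.JointlyGaussian M₂) {M : RandomMeasure P (X × Y)}
    (h : M₁.IsTensorProduct M₂ M) {C : RealMeasure (X × Y)} (hC : M₁.IsCrossCovariance M₂ C)
    (h₁ : M₁.IsCentred) (h₂ : M₂.IsCentred) {T T' : RealMeasure ((X × Y) × (X × Y))}
    (hT : IsReorderedProduct M₁.covMeasure M₂.covMeasure T) (hT' : IsCrossedProduct C T') :
    M.covMeasure = T + T' := by
  refine LocalVectorMeasure.ext_prod_prod fun A₁ A₂ B₁ B₂ hA₁ hA₂ hB₁ hB₂ => ?_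
  have hmul : ∫ ω, M (A₁ ×ˢ B₁) ω * M (A₂ ×ˢ B₂) ω ∂P
      = ∫ ω, M₁ A₁ ω * M₂ B₁ ω * (M₁ A₂ ω * M₂ B₂ ω) ∂P := by
    refine integral_congr_ae ?_
    filter_upwards [h _ _ hA₁ hB₁, h _ _ hA₂ hB₂] with ω h1 h2
    rw [h1, h2]
  rw [M.covMeasure_prod (hA₁.prod hB₁) (hA₂.prod hB₂), Lp.covariance_eq_sub, hmul,
    hG.integral_mul_mul_mul hA₁ hA₂ hB₁ hB₂, integral_congr_ae (h _ _ hA₁ hB₁),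
    integral_congr_ae (h _ _ hA₂ hB₂), LocalVectorMeasure.add_apply, hT _ _ _ _ hA₁ hA₂ hB₁ hB₂,
    hT' _ _ _ _ hA₁ hA₂ hB₁ hB₂, M₁.covMeasure_prod hA₁ hA₂, M₂.covMeasure_prod hB₁ hB₂,
    ← hC _ _ hA₁ hB₂, ← hC _ _ hA₂ hB₁]
  simp only [Lp.covariance_eq_sub, h₁ _ hA₁, h₁ _ hA₂, h₂ _ hB₁, h₂ _ hB₂]
  ring

end RandomMeasure

theorem mainTheorem6 {Ω : Type*} [MeasurableSpace Ω] (P : Measure Ω) [IsProbabilityMeasure P]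
    (d p : ℕ)
    (M₁ : RandomMeasure P (EuclideanSpace ℝ (Fin d)))
    (M₂ : RandomMeasure P (EuclideanSpace ℝ (Fin p)))
    (hGauss : M₁.JointlyGaussian M₂)
    (C₁₂ : RealMeasure (EuclideanSpace ℝ (Fin d) × EuclideanSpace ℝ (Fin p)))
    (hC₁₂ : M₁.IsCrossCovariance M₂ C₁₂) :
    (∃! M : RandomMeasure P (EuclideanSpace ℝ (Fin d) × EuclideanSpace ℝ (Fin p)),
      M₁.IsTensorProduct M₂ M) ∧
    (∃! T : RealMeasure ((EuclideanSpace ℝ (Fin d) × EuclideanSpace ℝ (Fin p)) ×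
        (EuclideanSpace ℝ (Fin d) × EuclideanSpace ℝ (Fin p))),
      IsReorderedProduct M₁.covMeasure M₂.covMeasure T) ∧
    (∃! T : RealMeasure ((EuclideanSpace ℝ (Fin d) × EuclideanSpace ℝ (Fin p)) ×
        (EuclideanSpace ℝ (Fin d) × EuclideanSpace ℝ (Fin p))),
      IsCrossedProduct C₁₂ T) ∧
    (M₁.IsCentred → M₂.IsCentred → ∀ M T T',
      M₁.IsTensorProduct M₂ M →
      IsReorderedProduct M₁.covMeasure M₂.covMeasure T → IsCrossedProduct C₁₂ T' →
      M.meanMeasure = C₁₂ ∧ M.covMeasure = T + T') := by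
  obtain ⟨M, hM⟩ := hGauss.exists_isTensorProduct hC₁₂
  obtain ⟨T, hT⟩ := LocalVectorMeasure.exists_isReorderedProduct M₁.covMeasure M₂.covMeasure
  obtain ⟨T', hT'⟩ := LocalVectorMeasure.exists_isCrossedProduct C₁₂
  refine ⟨⟨M, hM, fun N hN => hN.unique hM⟩,
    ⟨T, hT, fun S hS => LocalVectorMeasure.ext_prod_prod fun A₁ A₂ B₁ B₂ hA₁ hA₂ hB₁ hB₂ =>
      (hS _ _ _ _ hA₁ hA₂ hB₁ hB₂).trans (hT _ _ _ _ hA₁ hA₂ hB₁ hB₂).symm⟩,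
    ⟨T', hT', fun S hS => LocalVectorMeasure.ext_prod_prod fun A₁ A₂ B₁ B₂ hA₁ hA₂ hB₁ hB₂ =>
      (hS _ _ _ _ hA₁ hA₂ hB₁ hB₂).trans (hT' _ _ _ _ hA₁ hA₂ hB₁ hB₂).symm⟩,
    fun h₁ h₂ N S S' hN hS hS' =>
      ⟨hN.meanMeasure_eq hC₁₂ h₁, hN.covMeasure_eq hGauss hC₁₂ h₁ h₂ hS hS'⟩⟩
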